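/- Let $R$ be a discrete valuation ring with maximal ideal $\mathfrak m$ and residue field $k$, and assume that $R$ is not $\mathfrak m$-adically complete. Let $\widehat R$ be the $\mathfrak m$-adic completion of $R$, let $K=Q(R)$ and $\widetilde K=Q(\widehat R)$ be the fraction fields, and let $E=E_R(k)=E_{\widehat R}(k)$ be the injective hull of $k$ (over $R$, equivalently over $\widehat R$). Regard $\operatorname{Ext}^i_R(\widehat R,R)$ as an $\widehat R$-module through its first argument. If $[\widetilde K:K]=A<\infty$, then $A\geq 2$, $\operatorname{Ext}^i_R(\widehat R,R)=0$ for all $i\neq 1$, and there is an isomorphism of $\widehat R$-modules $$\operatorname{Ext}^1_R(\widehat R,R)\cong E\oplus \widetilde K^{A-2}.$$ -/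

import Mathlib

universe u

/-- The module `Ext^i_R(S, M)` for a commutative `R`-algebra `S` and an `R`-module `M`. -/
def ExtFromAlgebra (R : Type u) [CommRing R] (S : Type u) [CommRing S] [Algebra R S]
    (M : Type u) [AddCommGroup M] [Module R M] (i : ℕ) : Type u :=
  CategoryTheory.Abelian.Ext.{u} (ModuleCat.of R S) (ModuleCat.of R M) i

namespace ExtFromAlgebra

open CategoryTheory CategoryTheory.Abelian

variable (R : Type u) [CommRing R] (S : Type u) [CommRing S] [Algebra R S]
  (M : Type u) [AddCommGroup M] [Module R M] (i : ℕ)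

noncomputable instance : AddCommGroup (ExtFromAlgebra R S M i) :=
  inferInstanceAs (AddCommGroup (Ext.{u} (ModuleCat.of R S) (ModuleCat.of R M) i))

/-- Multiplication by `s : S`, as an endomorphism of the `R`-module `S`. -/
def mulHom (s : S) : ModuleCat.of R S ⟶ ModuleCat.of R S :=
  ModuleCat.ofHom (LinearMap.mulLeft R s)

/-- The `S`-module structure on `Ext^i_R(S, M)`, through functoriality in the first variable:
`s : S` acts as the map which multiplication by `s` on `S` induces on `Ext^i_R(S, M)`. -/
noncomputable instance : Module S (ExtFromAlgebra R S M i) where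
  smul s e := Ext.comp (Z := ModuleCat.of R M) (Ext.mk₀ (mulHom R S s)) e (zero_add i)
  one_smul e := by
    have h : mulHom R S (1 : S) = 𝟙 _ := by
      ext x; simp [mulHom]
    change (Ext.mk₀ (mulHom R S 1)).comp _ (zero_add i) = _
    rw [h]
    exact Ext.mk₀_id_comp _
  mul_smul s t e := by
    have h : mulHom R S (s * t) = mulHom R S s ≫ mulHom R S t := by
      ext x; simp [mulHom, mul_left_comm]
    change (Ext.mk₀ (mulHom R S (s * t))).comp _ (zero_add i) =
      (Ext.mk₀ (mulHom R S s)).comp ((Ext.mk₀ (mulHom R S t)).comp _ (zero_add i)) (zero_add i)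
    rw [h]
    exact (Ext.mk₀_comp_mk₀_assoc _ _ _).symm
  smul_zero s := Ext.comp_zero (Z := ModuleCat.of R M) (Ext.mk₀ (mulHom R S s)) i i (zero_add i)
  smul_add s e₁ e₂ := Ext.comp_add _ _ _ _
  add_smul s t e := by
    have h : mulHom R S (s + t) = mulHom R S s + mulHom R S t := by
      ext x; exact add_mul s t x
    change (Ext.mk₀ (mulHom R S (s + t))).comp _ (zero_add i) = _
    rw [h, Ext.mk₀_add]
    exact Ext.add_comp _ _ _ _
  zero_smul e := by
    have h : mulHom R S (0 : S) = 0 := by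
      ext x; simp [mulHom]
    change (Ext.mk₀ (mulHom R S 0)).comp _ (zero_add i) = _
    rw [h, Ext.mk₀_zero]
    exact Ext.zero_comp (Y := ModuleCat.of R S) (Z := ModuleCat.of R M) (X := ModuleCat.of R S) (n := 0)
      e i (zero_add i)

end ExtFromAlgebra

/-- `E` is an injective hull of the `A`-module `M`: it is an injective `A`-module
with an essential embedding `M → E`. -/
def IsInjectiveHull (A : Type u) [CommRing A] (M : Type u) [AddCommGroup M] [Module A M]
    (E : Type u) [AddCommGroup E] [Module A E] : Prop :=
  Module.Injective A E ∧
    ∃ f : M →ₗ[A] E, Function.Injective f ∧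
      ∀ N : Submodule A E, N ⊓ LinearMap.range f = ⊥ → N = ⊥

/-- The completion of a local ring with respect to its maximal ideal. -/
abbrev LocalCompletion (R : Type u) [CommRing R] [IsLocalRing R] : Type u :=
  AdicCompletion (IsLocalRing.maximalIdeal R) R

/-! Write S for the completion, L for its fraction field, p for a uniformizer of R. The core uses
only that p stays a uniformizer of S, that R is p-adically dense in S, and that S is complete. Then
L = K + S and K ∩ S = R, so K/R is L/S, and 0 → R → K → L/S → 0 is an injective resolution of R
(`fractionRing_exact`); L/S is the injective hull of the residue field over both rings. Hence Ext
vanishes from degree 2 on. Degree 0 vanishes because a map S → R is multiplication by its value at 1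
(`IsDenseModulo.eq_zero_of_not_surjective`).

Ext¹ is the cokernel of Hom_R(S, K) → Hom_R(S, L/S). By completeness every map S → L/S lifts to S →
L (`IsDenseModulo.exists_lift`), so End_K(L) = Hom_R(S, L) maps onto Ext¹. An endomorphism dies
exactly when, on S, it is a K-valued map plus an R-linear map S → S, and the latter is
multiplication by an element of S. The kernel is therefore S·id + Hom_K(L, K).

With L acting through the source, End_K(L) has dimension A and Hom_K(L, K) is a line
(`SourceHom.finrank_eq`), independent of id because L ≠ K. Dividing L^A by S ⊕ L leaves L/S ⊕
L^(A-2) (`nonempty_linearEquiv_of_ker_eq`). -/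

open IsLocalRing

/-! ### Divisible modules and injective hulls -/

/-- Over a principal ideal domain divisible modules are injective. -/
theorem injective_of_smul_surjective {A E : Type u} [CommRing A] [IsDomain A]
    [IsPrincipalIdealRing A] [AddCommGroup E] [Module A E]
    (h : ∀ a : A, a ≠ 0 → ∀ x : E, ∃ y : E, a • y = x) : Module.Injective A E := by
  refine Module.Baer.injective fun I g ↦ ?_
  obtain ⟨m, rfl⟩ := IsPrincipalIdealRing.principal I
  obtain rfl | h0 := eq_or_ne m 0
  · refine ⟨0, fun n hn ↦ ?_⟩
    rw [Submodule.span_zero_singleton] at hn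
    subst hn
    exact (map_zero g).symm
  obtain ⟨y, hy⟩ := h m h0 (g ⟨m, Submodule.subset_span (Set.mem_singleton _)⟩)
  refine ⟨LinearMap.toSpanSingleton A E y, fun n hn ↦ ?_⟩
  obtain ⟨n, rfl⟩ := Submodule.mem_span_singleton.mp hn
  rw [map_smul, LinearMap.toSpanSingleton_apply, hy, ← map_smul g, SetLike.mk_smul_mk]

/-- Over a discrete valuation ring divisibility by a uniformizer implies divisibility. -/
theorem exists_smul_eq_of_irreducible {A E : Type*} [CommRing A] [IsDomain A]
    [IsDiscreteValuationRing A] [AddCommGroup E] [Module A E] {p : A} (hp : Irreducible p)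
    (h : ∀ x : E, ∃ y : E, p • y = x) (a : A) (ha : a ≠ 0) (x : E) : ∃ y : E, a • y = x := by
  obtain ⟨n, u, rfl⟩ := IsDiscreteValuationRing.eq_unit_mul_pow_irreducible ha hp
  have hpow : ∀ (n : ℕ) (x : E), ∃ y : E, p ^ n • y = x := by
    intro n
    induction n with
    | zero => exact fun x ↦ ⟨x, by simp⟩
    | succ n ih =>
      intro x
      obtain ⟨y, rfl⟩ := ih x
      obtain ⟨z, rfl⟩ := h y
      exact ⟨z, by rw [pow_succ, mul_smul]⟩
  obtain ⟨y, hy⟩ := hpow n ((↑u⁻¹ : A) • x)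
  exact ⟨y, by rw [mul_smul, hy, smul_smul, Units.mul_inv, one_smul]⟩

/-- A divisible torsion module over a discrete valuation ring whose socle is generated by one
nonzero element is an injective hull of the residue field. -/
theorem IsInjectiveHull.of_socle {A E : Type u} [CommRing A] [IsDomain A]
    [IsDiscreteValuationRing A] [AddCommGroup E] [Module A E] {p : A} (hp : Irreducible p)
    (hdiv : ∀ x : E, ∃ y : E, p • y = x) (htor : ∀ x : E, ∃ n : ℕ, p ^ n • x = 0)
    {e : E} (he : e ≠ 0) (hpe : p • e = 0) (hsoc : ∀ x : E, p • x = 0 → ∃ a : A, a • e = x) :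
    IsInjectiveHull A (ResidueField A) E := by
  refine ⟨injective_of_smul_surjective (exists_smul_eq_of_irreducible hp hdiv), ?_⟩
  have hle : maximalIdeal A ≤ LinearMap.ker (LinearMap.toSpanSingleton A E e) := by
    rw [hp.maximalIdeal_eq, Ideal.span_le, Set.singleton_subset_iff]
    simpa using hpe
  have hker : LinearMap.ker (LinearMap.toSpanSingleton A E e) = maximalIdeal A := by
    refine ((maximalIdeal.isMaximal A).eq_of_le ?_ hle).symm
    intro htop
    have : (1 : A) ∈ LinearMap.ker (LinearMap.toSpanSingleton A E e) := by
      rw [htop]; trivial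
    exact he (by simpa using this)
  let f : ResidueField A →ₗ[A] E :=
    Submodule.liftQ (maximalIdeal A) (LinearMap.toSpanSingleton A E e) hle
  have hf : ∀ a : A, f (Submodule.Quotient.mk a : A ⧸ maximalIdeal A) = a • e := fun a ↦ rfl
  refine ⟨f, ?_, fun N hN ↦ ?_⟩
  · refine LinearMap.ker_eq_bot.mp ?_
    exact Submodule.ker_liftQ_eq_bot _ _ _ hker.le
  · by_contra hne
    obtain ⟨x, hxN, hx⟩ := Submodule.exists_mem_ne_zero_of_ne_bot hne
    classical
    -- The last nonzero multiple of x by a power of p lies in the socle, hence both in N and in the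
    -- range of f.
    have hn := Nat.find_spec (htor x)
    have hmin := fun m ↦ Nat.find_min (htor x) (m := m)
    generalize Nat.find (htor x) = n at hn hmin
    obtain _ | n := n
    · exact hx (by simpa using hn)
    · obtain ⟨a, ha⟩ := hsoc (p ^ n • x) (by rw [smul_smul, ← pow_succ', hn])
      have hmem : p ^ n • x ∈ N ⊓ LinearMap.range f :=
        ⟨N.smul_mem _ hxN, ⟨(Submodule.Quotient.mk a : A ⧸ maximalIdeal A), (hf a).trans ha⟩⟩
      rw [hN] at hmem
      exact hmin n n.lt_succ_self hmem

/-- Injective hulls are unique up to isomorphism. -/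
theorem IsInjectiveHull.nonempty_linearEquiv {A M E E' : Type u} [CommRing A] [AddCommGroup M]
    [Module A M] [AddCommGroup E] [Module A E] [AddCommGroup E'] [Module A E']
    (hE : IsInjectiveHull A M E) (hE' : IsInjectiveHull A M E') : Nonempty (E ≃ₗ[A] E') := by
  obtain ⟨hinj, f, hf, hess⟩ := hE
  obtain ⟨hinj', f', hf', hess'⟩ := hE'
  obtain ⟨g, hg⟩ := hinj'.out f hf f'
  have hgi : Function.Injective g := by
    refine LinearMap.ker_eq_bot.mp (hess _ (eq_bot_iff.mpr ?_))
    rintro _ ⟨hx, y, rfl⟩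
    have : f' y = 0 := by rw [← hg]; exact hx
    rw [hf' (this.trans (map_zero f').symm), map_zero]
    exact zero_mem _
  -- A retraction of g is injective on the range of f', hence injective by essentiality; this makes
  -- g surjective.
  obtain ⟨r, hr⟩ := hinj.out g hgi LinearMap.id
  have hker : LinearMap.ker r = ⊥ := by
    refine hess' _ (eq_bot_iff.mpr ?_)
    rintro _ ⟨hx, y, rfl⟩
    have h1 : f y = 0 := by
      have := hr (f y)
      rw [hg] at this
      exact this.symm.trans hx
    rw [hf (h1.trans (map_zero f).symm), map_zero]
    exact zero_mem _
  refine ⟨LinearEquiv.ofBijective g ⟨hgi, fun y ↦ ⟨r y, ?_⟩⟩⟩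
  exact LinearMap.ker_eq_bot.mp hker (hr (r y))

/-! ### The completion is a discrete valuation ring with the same uniformizer -/

namespace LocalCompletion

variable (R : Type u) [CommRing R] [IsDomain R] [IsDiscreteValuationRing R]

theorem maximalIdeal_eq_span {p : R} (hp : Irreducible p) :
    maximalIdeal (LocalCompletion R) = Ideal.span {algebraMap R (LocalCompletion R) p} := by
  have h := congrArg (Ideal.map (algebraMap R (LocalCompletion R))) hp.maximalIdeal_eq
  rw [Ideal.map_span, Set.image_singleton] at h
  exact AdicCompletion.maximalIdeal_eq_map.trans h

/-- The completion is generated over itself by the ring and a uniformizer. -/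
theorem exists_eq_add_mul {p : R} (hp : Irreducible p) (s : LocalCompletion R) :
    ∃ (r : R) (t : LocalCompletion R),
      s = algebraMap R _ r + algebraMap R (LocalCompletion R) p * t := by
  obtain ⟨y, hy⟩ := (AdicCompletion.residueField_map_bijective R).2 (residue _ s)
  obtain ⟨r, rfl⟩ := residue_surjective y
  rw [ResidueField.map_residue] at hy
  have hmem := (Ideal.Quotient.mk_eq_mk_iff_sub_mem _ _).mp hy.symm
  rw [maximalIdeal_eq_span R hp, Ideal.mem_span_singleton] at hmem
  obtain ⟨t, ht⟩ := hmem
  exact ⟨r, t, by rw [← ht]; ring⟩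

theorem algebraMap_injective : Function.Injective (algebraMap R (LocalCompletion R)) := by
  have h := AdicCompletion.of_injective (maximalIdeal R) R
  exact h

/-- The completion is Hausdorff, so some power of p fails to divide s. Dividing by the largest power
that does leaves an element outside the maximal ideal, that is, a unit. -/
theorem exists_eq_pow_mul_unit {p : R} (hp : Irreducible p) {s : LocalCompletion R} (hs : s ≠ 0) :
    ∃ (n : ℕ) (u : (LocalCompletion R)ˣ), algebraMap R (LocalCompletion R) p ^ n * u = s := by
  set q := algebraMap R (LocalCompletion R) p with hq
  have hex : ∃ n : ℕ, ¬ q ^ n ∣ s := by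
    by_contra! hall
    refine hs ((inferInstance : IsHausdorff (maximalIdeal (LocalCompletion R))
      (LocalCompletion R)).haus s fun n ↦ ?_)
    rw [SModEq.zero, smul_eq_mul, Ideal.mul_top, maximalIdeal_eq_span R hp,
      Ideal.span_singleton_pow, Ideal.mem_span_singleton]
    exact hall n
  classical
  have hn := Nat.find_spec hex
  have hmin := fun m ↦ Nat.find_min hex (m := m)
  generalize Nat.find hex = n at hn hmin
  obtain _ | n := n
  · simp at hn
  · obtain ⟨t, rfl⟩ := not_not.mp (hmin n n.lt_succ_self)
    have ht : IsUnit t := by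
      by_contra h
      have h' : t ∈ maximalIdeal (LocalCompletion R) := (mem_maximalIdeal _).mpr h
      rw [maximalIdeal_eq_span R hp, Ideal.mem_span_singleton] at h'
      obtain ⟨v, rfl⟩ := h'
      exact hn ⟨v, by rw [pow_succ, mul_assoc]⟩
    exact ⟨n, ht.unit, rfl⟩

instance : IsDomain (LocalCompletion R) := by
  have : NoZeroDivisors (LocalCompletion R) := by
    obtain ⟨p, hp⟩ := IsDiscreteValuationRing.exists_irreducible R
    refine ⟨fun {a b} hab ↦ ?_⟩
    by_contra! h
    obtain ⟨n, u, rfl⟩ := exists_eq_pow_mul_unit R hp h.1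
    obtain ⟨m, v, rfl⟩ := exists_eq_pow_mul_unit R hp h.2
    have h0 : algebraMap R (LocalCompletion R) p ^ (n + m) * ((u * v : (LocalCompletion R)ˣ)) = 0 := by
      rw [← hab]; push_cast; ring
    rw [Units.mul_left_eq_zero, ← map_pow] at h0
    exact pow_ne_zero _ hp.ne_zero (algebraMap_injective R (h0.trans (map_zero _).symm))
  exact NoZeroDivisors.to_isDomain _

theorem irreducible_algebraMap {p : R} (hp : Irreducible p) :
    Irreducible (algebraMap R (LocalCompletion R) p) := by
  refine IsDiscreteValuationRing.irreducible_of_span_eq_maximalIdeal _ ?_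
    (maximalIdeal_eq_span R hp)
  exact fun h ↦ hp.ne_zero (algebraMap_injective R (h.trans (map_zero _).symm))

instance : IsDiscreteValuationRing (LocalCompletion R) := by
  obtain ⟨p, hp⟩ := IsDiscreteValuationRing.exists_irreducible R
  refine IsDiscreteValuationRing.ofHasUnitMulPowIrreducibleFactorization
    ⟨_, irreducible_algebraMap R hp, fun {x} hx ↦ ?_⟩
  obtain ⟨n, u, h⟩ := exists_eq_pow_mul_unit R hp hx
  exact ⟨n, u, h⟩

theorem not_surjective_algebraMap (hR : ¬ IsAdicComplete (maximalIdeal R) R) :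
    ¬ Function.Surjective (algebraMap R (LocalCompletion R)) := fun h ↦
  hR (AdicCompletion.of_bijective_iff.mp ⟨algebraMap_injective R, h⟩)

end LocalCompletion

/-! ### Dense unramified extensions: rigidity of maps and lifting -/

section DenseExtension

variable {R S : Type*} [CommRing R] [IsDomain R] [IsDiscreteValuationRing R]
  [CommRing S] [IsDomain S] [IsDiscreteValuationRing S] [Algebra R S] {p : R}

/-- The image of `R` is dense in `S` for the topology defined by `p`. -/
def IsDenseModulo (S : Type*) [CommRing S] [Algebra R S] (p : R) : Prop :=
  ∀ s : S, ∃ (r : R) (t : S), s = algebraMap R S r + p • t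

omit [IsDomain R] [IsDiscreteValuationRing R] in
theorem mem_maximalIdeal_pow_iff_of_irreducible (hpS : Irreducible (algebraMap R S p)) (n : ℕ)
    (x : S) : x ∈ maximalIdeal S ^ n ↔ ∃ c : S, x = p ^ n • c := by
  rw [hpS.maximalIdeal_eq, Ideal.span_singleton_pow, Ideal.mem_span_singleton]
  simp only [Dvd.dvd, Algebra.smul_def, map_pow]

omit [IsDomain R] [IsDiscreteValuationRing R] in
theorem eq_zero_of_forall_eq_pow_smul (hpS : Irreducible (algebraMap R S p)) {x : S}
    (h : ∀ n : ℕ, ∃ c : S, x = p ^ n • c) : x = 0 := by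
  refine (inferInstance : IsHausdorff (maximalIdeal S) S).haus x fun n ↦ ?_
  rw [SModEq.zero, smul_eq_mul, Ideal.mul_top]
  exact (mem_maximalIdeal_pow_iff_of_irreducible hpS n x).mpr (h n)

omit [IsDomain R] [IsDiscreteValuationRing R] in
theorem exists_limit_of_eq_pow_smul [IsAdicComplete (maximalIdeal S) S]
    (hpS : Irreducible (algebraMap R S p)) (c : ℕ → S)
    (h : ∀ n m : ℕ, n ≤ m → ∃ d : S, c n - c m = p ^ n • d) :
    ∃ l : S, ∀ n, ∃ d : S, l - c n = p ^ n • d := by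
  obtain ⟨l, hl⟩ := (inferInstance : IsPrecomplete (maximalIdeal S) S).prec (f := c) (by
    intro n m hnm
    rw [SModEq.sub_mem, smul_eq_mul, Ideal.mul_top]
    exact (mem_maximalIdeal_pow_iff_of_irreducible hpS n _).mpr (h n m hnm))
  refine ⟨l, fun n ↦ ?_⟩
  have := hl n
  rw [SModEq.sub_mem, smul_eq_mul, Ideal.mul_top] at this
  obtain ⟨d, hd⟩ := (mem_maximalIdeal_pow_iff_of_irreducible hpS n _).mp this
  exact ⟨-d, by rw [smul_neg, ← hd]; ring⟩

omit [IsDomain R] [IsDiscreteValuationRing R] [IsDomain S] [IsDiscreteValuationRing S] in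
theorem IsDenseModulo.pow (hd : IsDenseModulo S p) (n : ℕ) (s : S) :
    ∃ (r : R) (t : S), s = algebraMap R S r + p ^ n • t := by
  induction n with
  | zero => exact ⟨0, s, by simp⟩
  | succ n ih =>
    obtain ⟨r, t, rfl⟩ := ih
    obtain ⟨r', t', rfl⟩ := hd t
    exact ⟨r + p ^ n * r', t', by simp only [Algebra.smul_def, map_add, map_mul, map_pow]; ring⟩

theorem algebraMap_injective_of_irreducible (hp : Irreducible p)
    (hpS : Irreducible (algebraMap R S p)) : Function.Injective (algebraMap R S) := by
  refine (injective_iff_map_eq_zero _).mpr fun r hr ↦ ?_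
  by_contra h
  obtain ⟨n, u, rfl⟩ := IsDiscreteValuationRing.eq_unit_mul_pow_irreducible h hp
  rw [map_mul, map_pow] at hr
  rcases mul_eq_zero.mp hr with h' | h'
  · exact (u.isUnit.map (algebraMap R S)).ne_zero h'
  · exact pow_ne_zero n hpS.ne_zero h'

omit [IsDomain R] [IsDiscreteValuationRing R] [IsDiscreteValuationRing S] in
theorem pow_smul_cancel {M : Type*} [CommRing M] [IsDomain M] [Algebra R M]
    (h0 : algebraMap R M p ≠ 0) (n : ℕ) {x y : M} (h : p ^ n • x = p ^ n • y) : x = y := by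
  simp only [Algebra.smul_def, map_pow] at h
  exact mul_left_cancel₀ (pow_ne_zero n h0) h

/-- Since p is a uniformizer in both rings, an element of R has the same valuation in S, so
divisibility by powers of p descends from S to R. -/
theorem exists_eq_algebraMap_of_pow_smul_eq (hp : Irreducible p)
    (hpS : Irreducible (algebraMap R S p)) {n : ℕ} {r : R} {t : S}
    (h : p ^ n • t = algebraMap R S r) : ∃ r' : R, t = algebraMap R S r' ∧ r = p ^ n * r' := by
  have hinj := algebraMap_injective_of_irreducible hp hpS
  by_cases hr : r = 0
  · refine ⟨0, pow_smul_cancel hpS.ne_zero n ?_, by simp [hr]⟩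
    rw [h, hr, map_zero, smul_zero]
  obtain ⟨m, u, rfl⟩ := IsDiscreteValuationRing.eq_unit_mul_pow_irreducible hr hp
  have hdvd : algebraMap R S p ^ n ∣ algebraMap R S p ^ m := by
    refine ⟨t * algebraMap R S (↑u⁻¹ : R), ?_⟩
    have h1 : algebraMap R S (u : R) * algebraMap R S (↑u⁻¹ : R) = 1 := by
      rw [← map_mul, Units.mul_inv, map_one]
    simp only [Algebra.smul_def, map_mul, map_pow] at h
    rw [← mul_assoc, h]
    linear_combination (-(algebraMap R S p) ^ m) * h1
  have hnm : n ≤ m := (pow_dvd_pow_iff hpS.ne_zero hpS.not_isUnit).mp hdvd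
  obtain ⟨k, rfl⟩ := Nat.exists_eq_add_of_le hnm
  refine ⟨u * p ^ k, pow_smul_cancel hpS.ne_zero n ?_, by ring⟩
  rw [h, Algebra.smul_def, ← map_mul]
  congr 1
  ring

omit [IsDomain R] [IsDiscreteValuationRing R] in
/-- Additive maps linear over a dense subring are linear. -/
theorem IsDenseModulo.map_eq_mul (hd : IsDenseModulo S p) (hpS : Irreducible (algebraMap R S p))
    (f : S →ₗ[R] S) (s : S) : f s = s * f 1 := by
  rw [← sub_eq_zero]
  refine eq_zero_of_forall_eq_pow_smul hpS fun n ↦ ?_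
  obtain ⟨r, t, rfl⟩ := hd.pow n s
  -- The contribution of r cancels by R-linearity, so the difference is divisible by every power of
  -- p.
  refine ⟨f t - t * f 1, ?_⟩
  rw [Algebra.algebraMap_eq_smul_one, map_add, map_smul, map_smul]
  simp only [Algebra.smul_def]
  ring

/-- Followed by R → S, the map g is multiplication by g 1. If g 1 is a unit times p ^ n, then every
p ^ n s comes from R, hence so does every s, and R → S is onto. -/
theorem IsDenseModulo.eq_zero_of_not_surjective (hd : IsDenseModulo S p) (hp : Irreducible p)
    (hpS : Irreducible (algebraMap R S p)) (hsurj : ¬ Function.Surjective (algebraMap R S))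
    (g : S →ₗ[R] R) : g = 0 := by
  have hinj := algebraMap_injective_of_irreducible hp hpS
  have hg : ∀ s, algebraMap R S (g s) = s * algebraMap R S (g 1) := fun s ↦
    hd.map_eq_mul hpS ((Algebra.linearMap R S).comp g) s
  by_cases h1 : g 1 = 0
  · ext s
    refine hinj ?_
    rw [hg, h1, map_zero, mul_zero, LinearMap.zero_apply, map_zero]
  · refine (hsurj fun s ↦ ?_).elim
    obtain ⟨n, u, hu⟩ := IsDiscreteValuationRing.eq_unit_mul_pow_irreducible h1 hp
    have h := hg (s * algebraMap R S (↑u⁻¹ : R))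
    have hu' : algebraMap R S (↑u⁻¹ : R) * algebraMap R S (u : R) = 1 := by
      rw [← map_mul, Units.inv_mul, map_one]
    rw [hu, map_mul (algebraMap R S), mul_assoc, ← mul_assoc (algebraMap R S (↑u⁻¹ : R)), hu',
      one_mul] at h
    obtain ⟨r', hr', -⟩ := exists_eq_algebraMap_of_pow_smul_eq hp hpS (n := n) (t := s)
      (r := g (s * algebraMap R S (↑u⁻¹ : R)))
      (by rw [h, Algebra.smul_def, map_pow, mul_comm])
    exact ⟨r', hr'.symm⟩

/-- The quotient of the fraction field by the ring, as a module over the ring. -/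
abbrev FractionQuotient (S L : Type*) [CommRing S] [CommRing L] [Algebra S L] : Type _ :=
  L ⧸ LinearMap.range (Algebra.linearMap S L)

variable {K L : Type*} [Field K] [Algebra R K] [IsFractionRing R K] [Field L] [Algebra S L]
  [IsFractionRing S L]

omit [IsDomain S] [IsDiscreteValuationRing S] [IsFractionRing S L] in
theorem mk_eq_mk_iff_exists_algebraMap {x y : L} :
    (Submodule.Quotient.mk x : FractionQuotient S L) = Submodule.Quotient.mk y ↔
      ∃ s : S, x - y = algebraMap S L s := by
  rw [Submodule.Quotient.eq]
  exact ⟨fun ⟨s, hs⟩ ↦ ⟨s, hs.symm⟩, fun ⟨s, hs⟩ ↦ ⟨s, hs.symm⟩⟩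

theorem exists_pow_mul_eq_algebraMap {q : S} (hq : Irreducible q) (x : L) :
    ∃ (n : ℕ) (s : S), q ^ n • x = algebraMap S L s := by
  obtain ⟨a, b, hb, rfl⟩ := IsFractionRing.div_surjective (A := S) x
  obtain ⟨n, u, rfl⟩ :=
    IsDiscreteValuationRing.eq_unit_mul_pow_irreducible (nonZeroDivisors.ne_zero hb) hq
  refine ⟨n, a * (↑u⁻¹ : S), ?_⟩
  have h0 : algebraMap S L (u * q ^ n) ≠ 0 :=
    IsFractionRing.to_map_ne_zero_of_mem_nonZeroDivisors hb
  have h1 : algebraMap S L (u : S) * algebraMap S L (↑u⁻¹ : S) = 1 := by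
    rw [← map_mul, Units.mul_inv, map_one]
  rw [Algebra.smul_def, mul_div_assoc', div_eq_iff h0]
  simp only [map_mul, map_pow]
  linear_combination (-(algebraMap S L q) ^ n * algebraMap S L a) * h1

variable [Algebra R L] [IsScalarTower R S L] [Algebra K L] [IsScalarTower R K L]

omit [IsDomain R] [IsDiscreteValuationRing R] in
/-- The fraction field of the completion is generated by the completion and the fraction field
of the ring. -/
theorem IsDenseModulo.exists_add_eq (hd : IsDenseModulo S p) (hp : Irreducible p)
    (hpS : Irreducible (algebraMap R S p)) (x : L) :
    ∃ (k : K) (s : S), x = algebraMap K L k + algebraMap S L s := by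
  obtain ⟨n, s, hs⟩ := exists_pow_mul_eq_algebraMap hpS x
  obtain ⟨r, t, rfl⟩ := hd.pow n s
  have hpK : algebraMap R K p ≠ 0 := fun h ↦
    hp.ne_zero (IsFractionRing.injective R K (h.trans (map_zero _).symm))
  have hpL : algebraMap R L p ≠ 0 := by
    rw [IsScalarTower.algebraMap_apply R K L]
    exact fun h ↦ hpK ((algebraMap K L).injective (h.trans (map_zero _).symm))
  refine ⟨algebraMap R K r / algebraMap R K p ^ n, t, ?_⟩
  rw [map_div₀, map_pow, ← IsScalarTower.algebraMap_apply, ← IsScalarTower.algebraMap_apply]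
  rw [← map_pow, Algebra.smul_def, ← IsScalarTower.algebraMap_apply, map_add,
    ← IsScalarTower.algebraMap_apply, Algebra.smul_def, map_mul,
    ← IsScalarTower.algebraMap_apply, map_pow] at hs
  field_simp
  linear_combination hs

/-- An element of the fraction field of `R` lying in the completion lies in `R`. -/
theorem exists_algebraMap_eq_of_eq (hp : Irreducible p) (hpS : Irreducible (algebraMap R S p))
    {k : K} {s : S} (h : algebraMap K L k = algebraMap S L s) :
    ∃ r : R, k = algebraMap R K r ∧ s = algebraMap R S r := by
  obtain ⟨n, r, hr⟩ := exists_pow_mul_eq_algebraMap hp k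
  have h1 : p ^ n • s = algebraMap R S r := by
    refine IsFractionRing.injective S L ?_
    rw [Algebra.smul_def, map_mul, ← h, ← IsScalarTower.algebraMap_apply,
      ← IsScalarTower.algebraMap_apply, IsScalarTower.algebraMap_apply R K L, ← map_mul,
      ← Algebra.smul_def, hr, ← IsScalarTower.algebraMap_apply]
  obtain ⟨r', rfl, -⟩ := exists_eq_algebraMap_of_pow_smul_eq hp hpS h1
  refine ⟨r', (algebraMap K L).injective ?_, rfl⟩
  rw [h, ← IsScalarTower.algebraMap_apply, ← IsScalarTower.algebraMap_apply]

omit [IsFractionRing S L] in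
-- As f kills R, writing s = r + p ^ n t gives f s = p ^ n f t, so a lift of f t determines a lift
-- of f s modulo p ^ n S. This is the consistency of these approximations for varying n.
theorem mk_smul_sub_eq (hp : Irreducible p) (hpS : Irreducible (algebraMap R S p))
    {f : S →ₗ[R] FractionQuotient S L} (hf : f 1 = 0) {n m : ℕ} (hnm : n ≤ m) {r r' : R} {t t' : S}
    {y y' : L} (h : algebraMap R S r + p ^ n • t = algebraMap R S r' + p ^ m • t')
    (hy : Submodule.Quotient.mk y = f t) (hy' : Submodule.Quotient.mk y' = f t') :
    ∃ c : S, p ^ n • y - p ^ m • y' = p ^ n • algebraMap S L c := by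
  obtain ⟨k, rfl⟩ := Nat.exists_eq_add_of_le hnm
  obtain ⟨a, ha, -⟩ := exists_eq_algebraMap_of_pow_smul_eq hp hpS (n := n) (r := r' - r)
    (t := t - p ^ k • t') (by
      rw [smul_sub, smul_smul, ← pow_add, map_sub]
      linear_combination h)
  have h2 : f t = p ^ k • f t' := by
    rw [← sub_eq_zero, ← map_smul, ← map_sub, ha, Algebra.algebraMap_eq_smul_one, map_smul, hf,
      smul_zero]
  rw [← hy, ← hy', ← Submodule.Quotient.mk_smul] at h2
  obtain ⟨c, hc⟩ := mk_eq_mk_iff_exists_algebraMap.mp h2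
  exact ⟨c, by rw [← hc, smul_sub, smul_smul, ← pow_add]⟩

/-- If `S` is complete, maps from `S` to the quotient of its fraction field lift to the
fraction field. -/
theorem IsDenseModulo.exists_lift [IsAdicComplete (maximalIdeal S) S] (hd : IsDenseModulo S p)
    (hp : Irreducible p) (hpS : Irreducible (algebraMap R S p))
    (f : S →ₗ[R] FractionQuotient S L) :
    ∃ g : S →ₗ[R] L, ∀ s, Submodule.Quotient.mk (g s) = f s := by
  suffices H : ∀ f : S →ₗ[R] FractionQuotient S L, f 1 = 0 →
      ∃ g : S →ₗ[R] L, ∀ s, Submodule.Quotient.mk (g s) = f s by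
    -- Subtracting multiplication by a lift of f 1, which visibly lifts, reduces to maps killing R.
    obtain ⟨a, ha⟩ := Submodule.Quotient.mk_surjective _ (f 1)
    let m : S →ₗ[R] L := ((LinearMap.toSpanSingleton S L a).restrictScalars R)
    let q : L →ₗ[R] FractionQuotient S L := (Submodule.mkQ _).restrictScalars R
    obtain ⟨g, hg⟩ := H (f - q.comp m) (by
      rw [LinearMap.sub_apply, sub_eq_zero, ← ha]
      simp [m, q])
    refine ⟨g + m, fun s ↦ ?_⟩
    rw [LinearMap.add_apply, Submodule.Quotient.mk_add, hg, LinearMap.sub_apply]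
    exact sub_add_cancel _ _
  intro f hf
  -- P s z says that z is a lift of f s compatible with the approximations at every level n.
  -- Separatedness of S makes z unique, completeness makes it exist, and uniqueness makes it
  -- R-linear in s.
  let P : S → L → Prop := fun s z ↦ ∀ n : ℕ, ∃ (r : R) (t : S) (y : L),
    s = algebraMap R S r + p ^ n • t ∧ Submodule.Quotient.mk y = f t ∧ z = p ^ n • y
  have huniq : ∀ s z z', P s z → P s z' → z = z' := by
    intro s z z' h h'
    have key : ∀ n : ℕ, ∃ c : S, z - z' = p ^ n • algebraMap S L c := by
      intro n
      obtain ⟨r, t, y, rfl, hy, rfl⟩ := h n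
      obtain ⟨r', t', y', hs, hy', rfl⟩ := h' n
      exact mk_smul_sub_eq hp hpS hf le_rfl hs hy hy'
    obtain ⟨c, hc⟩ := key 0
    rw [pow_zero, one_smul] at hc
    have hc0 : c = 0 := by
      refine eq_zero_of_forall_eq_pow_smul hpS fun n ↦ ?_
      obtain ⟨d, hd⟩ := key n
      refine ⟨d, IsFractionRing.injective S L ?_⟩
      rw [← hc, hd, Algebra.smul_def, Algebra.smul_def, map_mul, ← IsScalarTower.algebraMap_apply]
    rw [hc0, map_zero, sub_eq_zero] at hc
    exact hc
  have hex : ∀ s, ∃ z, P s z := by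
    intro s
    choose r t hrt using fun n ↦ hd.pow n s
    choose y hy using fun n ↦ Submodule.Quotient.mk_surjective _ (f (t n))
    have key : ∀ n m : ℕ, n ≤ m →
        ∃ c : S, p ^ n • y n - p ^ m • y m = p ^ n • algebraMap S L c := fun n m hnm ↦
      mk_smul_sub_eq hp hpS hf hnm ((hrt n).symm.trans (hrt m)) (hy n) (hy m)
    choose c hc using fun n ↦ key 0 n (Nat.zero_le n)
    simp only [pow_zero, one_smul] at hc
    obtain ⟨l, hl⟩ := exists_limit_of_eq_pow_smul hpS c (by
      intro n m hnm
      obtain ⟨d, hd⟩ := key n m hnm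
      refine ⟨-d, IsFractionRing.injective S L ?_⟩
      have h3 : algebraMap S L (p ^ n • -d) = -(p ^ n • algebraMap S L d) := by
        rw [Algebra.smul_def, map_mul, ← IsScalarTower.algebraMap_apply, map_neg, mul_neg,
          ← Algebra.smul_def]
      rw [map_sub, ← hc, ← hc, h3, ← hd]
      ring)
    -- The approximations are p ^ n y n = y 0 - c n, so their limit is y 0 - l.
    refine ⟨y 0 - algebraMap S L l, fun n ↦ ?_⟩
    obtain ⟨d, hd⟩ := hl n
    refine ⟨r n, t n, y n - algebraMap S L d, hrt n, ?_, ?_⟩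
    · rw [← hy n]
      exact mk_eq_mk_iff_exists_algebraMap.mpr ⟨-d, by rw [map_neg]; ring⟩
    · have h3 : algebraMap S L l - algebraMap S L (c n) = p ^ n • algebraMap S L d := by
        rw [← map_sub, hd, Algebra.smul_def, map_mul, ← IsScalarTower.algebraMap_apply,
          ← Algebra.smul_def]
      rw [smul_sub, ← h3, ← hc]
      ring
  choose g hg using hex
  refine ⟨{ toFun := g, map_add' := ?_, map_smul' := ?_ }, ?_⟩
  · intro a b
    refine huniq _ _ _ (hg _) fun n ↦ ?_
    obtain ⟨r, t, y, h1, h2, h3⟩ := hg a n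
    obtain ⟨r', t', y', h1', h2', h3'⟩ := hg b n
    refine ⟨r + r', t + t', y + y', ?_, ?_, ?_⟩
    · rw [h1, h1', map_add, smul_add]; ring
    · rw [Submodule.Quotient.mk_add, h2, h2', map_add]
    · rw [h3, h3', smul_add]
  · intro a b
    refine huniq _ _ _ (hg _) fun n ↦ ?_
    obtain ⟨r, t, y, h1, h2, h3⟩ := hg b n
    refine ⟨a * r, a • t, a • y, ?_, ?_, ?_⟩
    · rw [h1, map_mul, smul_add, smul_comm a, ← Algebra.smul_def]
    · rw [Submodule.Quotient.mk_smul, h2, map_smul]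
    · rw [h3, smul_comm, RingHom.id_apply]
  · intro s
    obtain ⟨r, t, y, h1, h2, h3⟩ := hg s 0
    rw [pow_zero, one_smul] at h1 h3
    change Submodule.Quotient.mk (g s) = f s
    rw [h3, h2, h1, map_add, Algebra.algebraMap_eq_smul_one, map_smul, hf, smul_zero, zero_add]

end DenseExtension

/-! ### Ext from an injective resolution of length one -/

namespace ExtFromAlgebra

open CategoryTheory CategoryTheory.Abelian

variable {R : Type u} [CommRing R] (S : Type u) [CommRing S] [Algebra R S]
  {M I J : Type u} [AddCommGroup M] [Module R M] [AddCommGroup I] [Module R I]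
  [AddCommGroup J] [Module R J]

theorem shortExact_of {i : M →ₗ[R] I} {q : I →ₗ[R] J} (hi : Function.Injective i)
    (hq : Function.Surjective q) (hiq : Function.Exact i q) :
    (ShortComplex.mk (ModuleCat.ofHom i) (ModuleCat.ofHom q)
      (by ext x; exact hiq.apply_apply_eq_zero x)).ShortExact where
  exact := (ShortComplex.ShortExact.moduleCat_exact_iff_function_exact _).mpr hiq
  mono_f := (ModuleCat.mono_iff_injective _).mpr hi
  epi_g := (ModuleCat.epi_iff_surjective _).mpr hq

/-- The connecting map of the first variable is compatible with the action of `S`. -/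
theorem exists_connecting {i : M →ₗ[R] I} {q : I →ₗ[R] J} (hi : Function.Injective i)
    (hq : Function.Surjective q) (hiq : Function.Exact i q) (hI : Module.Injective R I) :
    ∃ δ : (S →ₗ[R] J) →+ ExtFromAlgebra R S M 1, Function.Surjective δ ∧
      (∀ f, δ f = 0 ↔ ∃ h : S →ₗ[R] I, f = q ∘ₗ h) ∧
      ∀ (s : S) (f : S →ₗ[R] J), δ (f ∘ₗ LinearMap.mulLeft R s) = s • δ f := by
  have hE := shortExact_of hi hq hiq
  have hI' : Injective (ModuleCat.of R I) := Module.injective_object_of_injective_module R I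
  have hcomp : (Ext.mk₀ (ModuleCat.ofHom q)).comp hE.extClass (zero_add 1) = 0 := hE.comp_extClass
  let δ : (S →ₗ[R] J) →+ Ext.{u} (ModuleCat.of R S) (ModuleCat.of R M) 1 :=
    { toFun f := (Ext.mk₀ (ModuleCat.ofHom f)).comp hE.extClass (zero_add 1)
      map_zero' := by
        rw [ModuleCat.ofHom_zero, Ext.mk₀_zero, Ext.zero_comp]
      map_add' f g := by
        rw [ModuleCat.ofHom_add, Ext.mk₀_add, Ext.add_comp] }
  refine ⟨δ, ?_, ?_, ?_⟩
  · intro e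
    obtain ⟨x, hx⟩ := Ext.covariant_sequence_exact₁ (ModuleCat.of R S) hE e
      (Ext.eq_zero_of_injective _) (zero_add 1)
    obtain ⟨f, rfl⟩ := Ext.homEquiv₀.symm.surjective x
    exact ⟨f.hom, hx⟩
  · intro f
    constructor
    · intro (h : (Ext.mk₀ (ModuleCat.ofHom f)).comp hE.extClass (zero_add 1) = 0)
      obtain ⟨x, hx⟩ := Ext.covariant_sequence_exact₃ (ModuleCat.of R S) hE
        (Ext.mk₀ (ModuleCat.ofHom f)) (zero_add 1) h
      obtain ⟨g, rfl⟩ := Ext.homEquiv₀.symm.surjective x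
      refine ⟨g.hom, ?_⟩
      erw [Ext.mk₀_comp_mk₀] at hx
      have h2 := Ext.homEquiv₀.symm.injective hx
      exact (congrArg ModuleCat.Hom.hom h2).symm
    · rintro ⟨h, rfl⟩
      change (Ext.mk₀ (ModuleCat.ofHom h ≫ ModuleCat.ofHom q)).comp hE.extClass (zero_add 1) = 0
      rw [← Ext.mk₀_comp_mk₀_assoc]
      exact (congrArg (fun y ↦ (Ext.mk₀ (ModuleCat.ofHom h)).comp y (zero_add 1)) hcomp).trans
        (Ext.comp_zero _ _ _ _ _)
  · intro s f
    exact (Ext.mk₀_comp_mk₀_assoc (mulHom R S s) (ModuleCat.ofHom f) hE.extClass).symm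

/-- Dimension shifting: the connecting map from Ext of J in degree n + 1 is onto because I is
injective, and its source vanishes because J is. -/
theorem subsingleton_add_two {i : M →ₗ[R] I} {q : I →ₗ[R] J} (hi : Function.Injective i)
    (hq : Function.Surjective q) (hiq : Function.Exact i q) (hI : Module.Injective R I)
    (hJ : Module.Injective R J) (n : ℕ) : Subsingleton (ExtFromAlgebra R S M (n + 2)) := by
  have hE := shortExact_of hi hq hiq
  have hI' : Injective (ModuleCat.of R I) := Module.injective_object_of_injective_module R I
  have hJ' : Injective (ModuleCat.of R J) := Module.injective_object_of_injective_module R J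
  refine subsingleton_of_forall_eq 0 fun e ↦ ?_
  obtain ⟨x, hx⟩ := Ext.covariant_sequence_exact₁ (ModuleCat.of R S) hE e
    (Ext.eq_zero_of_injective _) (n₀ := n + 1) rfl
  exact hx.symm.trans ((congrArg (fun y ↦ y.comp hE.extClass rfl)
    (Ext.eq_zero_of_injective x)).trans (Ext.zero_comp _ _ _ _ _))

theorem subsingleton_zero (h : ∀ f : S →ₗ[R] M, f = 0) :
    Subsingleton (ExtFromAlgebra R S M 0) := by
  refine subsingleton_of_forall_eq 0 fun e ↦ ?_
  let φ := Ext.homEquiv₀ (X := ModuleCat.of R S) (Y := ModuleCat.of R M)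
  have h0 (x y : ModuleCat.of R S ⟶ ModuleCat.of R M) : x = y :=
    ModuleCat.hom_ext ((h x.hom).trans (h y.hom).symm)
  exact φ.injective (h0 (φ e) (φ 0))

end ExtFromAlgebra

/-! ### Linear algebra of Hom_K(L, V) with L acting on the source -/

/-- Linear maps between vector spaces over `K`, as a module over the field `L` acting through the
source. -/
def SourceHom (K L V : Type*) [Field K] [Field L] [Algebra K L] [AddCommGroup V] [Module K V] :
    Type _ :=
  L →ₗ[K] V

namespace SourceHom

variable (K L V : Type*) [Field K] [Field L] [Algebra K L] [AddCommGroup V] [Module K V]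

instance : AddCommGroup (SourceHom K L V) := inferInstanceAs (AddCommGroup (L →ₗ[K] V))

instance : Module K (SourceHom K L V) := inferInstanceAs (Module K (L →ₗ[K] V))

variable {K L V}

/-- The underlying linear map. -/
def toHom (f : SourceHom K L V) : L →ₗ[K] V := f

theorem ext {f g : SourceHom K L V} (h : ∀ x, toHom f x = toHom g x) : f = g := LinearMap.ext h

instance : SMul L (SourceHom K L V) where
  smul a f := (toHom f ∘ₗ LinearMap.mulLeft K a : L →ₗ[K] V)

theorem toHom_smul_apply (a : L) (f : SourceHom K L V) (x : L) :
    toHom (a • f) x = toHom f (a * x) := rfl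

theorem toHom_add_apply (f g : SourceHom K L V) (x : L) :
    toHom (f + g) x = toHom f x + toHom g x := rfl

theorem toHom_zero_apply (x : L) : toHom (0 : SourceHom K L V) x = 0 := rfl

theorem toHom_smul_left_apply (c : K) (f : SourceHom K L V) (x : L) :
    toHom (c • f) x = c • toHom f x := rfl

instance : Module L (SourceHom K L V) where
  one_smul f := ext fun x ↦ by rw [toHom_smul_apply, one_mul]
  mul_smul a b f := ext fun x ↦ by
    rw [toHom_smul_apply, toHom_smul_apply, toHom_smul_apply, mul_comm a, mul_assoc]
  smul_zero a := rfl
  smul_add a f g := rfl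
  add_smul a b f := ext fun x ↦ by
    rw [toHom_smul_apply, toHom_add_apply, toHom_smul_apply, toHom_smul_apply, add_mul, map_add]
  zero_smul f := ext fun x ↦ by rw [toHom_smul_apply, zero_mul, map_zero, toHom_zero_apply]

instance : IsScalarTower K L (SourceHom K L V) where
  smul_assoc c a f := ext fun x ↦ by
    rw [toHom_smul_apply, toHom_smul_left_apply, toHom_smul_apply, smul_mul_assoc, map_smul]

variable [FiniteDimensional K L] [FiniteDimensional K V]

instance : Module.Finite K (SourceHom K L V) := inferInstanceAs (Module.Finite K (L →ₗ[K] V))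

instance : FiniteDimensional L (SourceHom K L V) := Module.Finite.of_restrictScalars_finite K L _

variable (K L V) in
-- Count dimensions over K and cancel [L : K].
theorem finrank_eq : Module.finrank L (SourceHom K L V) = Module.finrank K V := by
  have h1 : Module.finrank K (SourceHom K L V) = Module.finrank K L * Module.finrank K V :=
    Module.finrank_linearMap K K L V
  rw [← Module.finrank_mul_finrank K L (SourceHom K L V)] at h1
  exact Nat.eq_of_mul_eq_mul_left Module.finrank_pos h1

end SourceHom

/-- The quotient of a finite-dimensional vector space over the fraction field of `S` by the sum of
a copy of `S` and an independent line. -/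
theorem nonempty_linearEquiv_of_ker_eq {S L W M : Type*} [CommRing S] [Field L] [Algebra S L]
    [AddCommGroup W] [Module L W] [Module S W] [IsScalarTower S L W] [FiniteDimensional L W]
    [AddCommGroup M] [Module S M] (Φ : W →ₗ[S] M) (hΦ : Function.Surjective Φ) {v w : W}
    (hvw : LinearIndependent L ![v, w])
    (hker : ∀ x, Φ x = 0 ↔ ∃ (s : S) (b : L), x = s • v + b • w) :
    Nonempty (M ≃ₗ[S] FractionQuotient S L × (Fin (Module.finrank L W - 2) → L)) := by
  let U : Submodule L W := Submodule.span L {v, w}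
  have hU : Module.finrank L U = 2 := by
    have := finrank_span_eq_card hvw
    rwa [Matrix.range_cons_cons_empty, Fintype.card_fin] at this
  have hQ : Module.finrank L (W ⧸ U) = Module.finrank L (Fin (Module.finrank L W - 2) → L) := by
    rw [Submodule.finrank_quotient, hU, Module.finrank_fin_fun]
  let e : (W ⧸ U) ≃ₗ[L] (Fin (Module.finrank L W - 2) → L) := LinearEquiv.ofFinrankEq _ _ hQ
  -- The v-coordinate on the span of v and w, extended to W.
  obtain ⟨φ, hφv, hφw⟩ : ∃ φ : W →ₗ[L] L, φ v = 1 ∧ φ w = 0 := by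
    let φ₀ : Submodule.span L (Set.range ![v, w]) →ₗ[L] L :=
      Finsupp.lapply 0 ∘ₗ hvw.repr
    obtain ⟨φ, hφ⟩ := φ₀.exists_extend
    have hmem (i : Fin 2) : φ (![v, w] i) = Finsupp.single i (1 : L) 0 := by
      rw [← hvw.repr_eq_single i ⟨_, Submodule.subset_span ⟨i, rfl⟩⟩ rfl]
      exact LinearMap.congr_fun hφ ⟨![v, w] i, Submodule.subset_span ⟨i, rfl⟩⟩
    exact ⟨φ, by simpa using hmem 0, by simpa using hmem 1⟩
  -- The second component vanishes on the plane spanned by v and w; there the first asks that the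
  -- v-coordinate lie in S. Thus Ψ and Φ have the same kernel.
  let Ψ : W →ₗ[S] FractionQuotient S L × (Fin (Module.finrank L W - 2) → L) :=
    ((Submodule.mkQ (LinearMap.range (Algebra.linearMap S L))) ∘ₗ (φ.restrictScalars S)).prod ((e.toLinearMap ∘ₗ U.mkQ).restrictScalars S)
  have hΨ : ∀ x, Ψ x = (Submodule.Quotient.mk (φ x), e (Submodule.Quotient.mk x)) := fun x ↦ rfl
  have hΨs : Function.Surjective Ψ := by
    rintro ⟨a, b⟩
    obtain ⟨a, rfl⟩ := Submodule.Quotient.mk_surjective _ a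
    obtain ⟨y, hy⟩ := Submodule.Quotient.mk_surjective _ (e.symm b)
    have hv : (Submodule.Quotient.mk v : W ⧸ U) = 0 :=
      (Submodule.Quotient.mk_eq_zero _).mpr (Submodule.subset_span (by simp))
    refine ⟨y + (a - φ y) • v, ?_⟩
    have h1 : (Submodule.Quotient.mk (y + (a - φ y) • v) : W ⧸ U) = e.symm b := by
      rw [Submodule.Quotient.mk_add, Submodule.Quotient.mk_smul, hv, hy, smul_zero, add_zero]
    rw [hΨ, h1, map_add, map_smul, hφv, smul_eq_mul, mul_one, add_sub_cancel,
      LinearEquiv.apply_symm_apply]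
  have hΨk : LinearMap.ker Ψ = LinearMap.ker Φ := by
    ext x
    rw [LinearMap.mem_ker, LinearMap.mem_ker, hker, hΨ, Prod.mk_eq_zero,
      Submodule.Quotient.mk_eq_zero, EmbeddingLike.map_eq_zero_iff, Submodule.Quotient.mk_eq_zero,
      Submodule.mem_span_pair]
    constructor
    · rintro ⟨⟨s, hs⟩, a, b, rfl⟩
      refine ⟨s, b, ?_⟩
      rw [map_add, map_smul, map_smul, hφv, hφw, smul_zero, add_zero, smul_eq_mul, mul_one] at hs
      rw [← hs, Algebra.linearMap_apply, algebraMap_smul]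
    · rintro ⟨s, b, rfl⟩
      refine ⟨⟨s, ?_⟩, algebraMap S L s, b, by rw [algebraMap_smul]⟩
      rw [← algebraMap_smul L s v, map_add, map_smul, map_smul, hφv, hφw, smul_zero, add_zero,
        smul_eq_mul, mul_one, Algebra.linearMap_apply]
  exact ⟨(Φ.quotKerEquivOfSurjective hΦ).symm ≪≫ₗ Submodule.quotEquivOfEq _ _ hΨk.symm ≪≫ₗ
    Ψ.quotKerEquivOfSurjective hΨs⟩

/-! ### The module L/S and the computation of Ext¹ -/

section DenseExtension

variable {R S K L : Type u} [CommRing R] [IsDomain R] [IsDiscreteValuationRing R]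
  [CommRing S] [IsDomain S] [IsDiscreteValuationRing S] [Algebra R S]
  [Field K] [Algebra R K] [IsFractionRing R K] [Field L] [Algebra S L] [IsFractionRing S L]
  [Algebra R L] [IsScalarTower R S L] {p : R}

omit [IsDomain R] [IsDiscreteValuationRing R] [IsDomain S] [IsDiscreteValuationRing S] in
theorem algebraMap_fractionRing_ne_zero (hpS : Irreducible (algebraMap R S p)) :
    algebraMap R L p ≠ 0 := by
  rw [IsScalarTower.algebraMap_apply R S L]
  exact fun h ↦ hpS.ne_zero (IsFractionRing.injective S L (h.trans (map_zero _).symm))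

omit [IsDomain R] [IsDiscreteValuationRing R] [IsDomain S] [IsDiscreteValuationRing S] in
theorem FractionQuotient.exists_smul_eq (hpS : Irreducible (algebraMap R S p))
    (x : FractionQuotient S L) : ∃ y : FractionQuotient S L, p • y = x := by
  obtain ⟨x, rfl⟩ := Submodule.Quotient.mk_surjective _ x
  refine ⟨Submodule.Quotient.mk ((algebraMap R L p)⁻¹ * x), ?_⟩
  rw [← Submodule.Quotient.mk_smul, Algebra.smul_def,
    mul_inv_cancel_left₀ (algebraMap_fractionRing_ne_zero hpS)]

omit [IsDomain R] [IsDiscreteValuationRing R] in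
theorem FractionQuotient.exists_pow_smul_eq_zero (hpS : Irreducible (algebraMap R S p))
    (x : FractionQuotient S L) : ∃ n : ℕ, p ^ n • x = 0 := by
  obtain ⟨x, rfl⟩ := Submodule.Quotient.mk_surjective _ x
  obtain ⟨n, s, hs⟩ := exists_pow_mul_eq_algebraMap hpS x
  refine ⟨n, ?_⟩
  rw [← Submodule.Quotient.mk_smul, Submodule.Quotient.mk_eq_zero]
  refine ⟨s, ?_⟩
  rw [Algebra.linearMap_apply, ← hs, ← map_pow, algebraMap_smul]

/-- The quotient of the fraction field of the completion by the completion is an injective hull of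
the residue field of `R`. -/
theorem FractionQuotient.isInjectiveHull_of_isDenseModulo (hd : IsDenseModulo S p)
    (hp : Irreducible p) (hpS : Irreducible (algebraMap R S p)) :
    IsInjectiveHull R (ResidueField R) (FractionQuotient S L) := by
  have hp0 := algebraMap_fractionRing_ne_zero (L := L) hpS
  refine IsInjectiveHull.of_socle hp (FractionQuotient.exists_smul_eq hpS)
    (FractionQuotient.exists_pow_smul_eq_zero hpS)
    (e := Submodule.Quotient.mk (algebraMap R L p)⁻¹) ?_ ?_ ?_
  · rw [Ne, Submodule.Quotient.mk_eq_zero]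
    rintro ⟨s, hs⟩
    refine hpS.not_isUnit (IsUnit.of_mul_eq_one s (IsFractionRing.injective S L ?_))
    rw [Algebra.linearMap_apply] at hs
    rw [map_mul, map_one, ← IsScalarTower.algebraMap_apply, hs, mul_inv_cancel₀ hp0]
  · rw [← Submodule.Quotient.mk_smul, Submodule.Quotient.mk_eq_zero]
    exact ⟨1, by rw [Algebra.smul_def, mul_inv_cancel₀ hp0, Algebra.linearMap_apply, map_one]⟩
  · intro x hx
    obtain ⟨x, rfl⟩ := Submodule.Quotient.mk_surjective _ x
    rw [← Submodule.Quotient.mk_smul, Submodule.Quotient.mk_eq_zero] at hx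
    obtain ⟨s, hs⟩ := hx
    -- A socle element is the class of s/p = r/p + t, which is r times the class of 1/p.
    obtain ⟨r, t, rfl⟩ := hd s
    refine ⟨r, ?_⟩
    rw [← Submodule.Quotient.mk_smul]
    refine mk_eq_mk_iff_exists_algebraMap.mpr ⟨-t, ?_⟩
    rw [Algebra.linearMap_apply, map_add, Algebra.smul_def, map_mul,
      ← IsScalarTower.algebraMap_apply, ← IsScalarTower.algebraMap_apply, Algebra.smul_def] at hs
    rw [Algebra.smul_def, map_neg]
    field_simp
    linear_combination hs

theorem FractionQuotient.isInjectiveHull :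
    IsInjectiveHull S (ResidueField S) (FractionQuotient S L) := by
  obtain ⟨q, hq⟩ := IsDiscreteValuationRing.exists_irreducible S
  exact FractionQuotient.isInjectiveHull_of_isDenseModulo (R := S) (p := q)
    (fun s ↦ ⟨s, 0, by simp⟩) hq hq

/-- Vector spaces over the fraction field are injective modules. -/
theorem injective_of_isFractionRing (V : Type u) [AddCommGroup V] [Module K V] [Module R V]
    [IsScalarTower R K V] : Module.Injective R V :=
  injective_of_smul_surjective fun a ha x ↦ by
    have ha' : algebraMap R K a ≠ 0 := fun h ↦
      ha (IsFractionRing.injective R K (h.trans (map_zero _).symm))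
    exact ⟨(algebraMap R K a)⁻¹ • x, by
      rw [← algebraMap_smul K a, smul_smul, mul_inv_cancel₀ ha', one_smul]⟩

variable [Algebra K L] [IsScalarTower R K L]

omit [IsDomain S] [IsDiscreteValuationRing S] in
/-- Maps from `S` to a vector space over `K` extend to the fraction field of `S`. -/
theorem exists_extension_fractionRing (V : Type u) [AddCommGroup V] [Module K V] [Module R V]
    [IsScalarTower R K V] (g : S →ₗ[R] V) :
    ∃ f : L →ₗ[K] V, ∀ s, f (algebraMap S L s) = g s := by
  obtain ⟨f, hf⟩ := (injective_of_isFractionRing (R := R) (K := K) V).out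
    (IsScalarTower.toAlgHom R S L).toLinearMap (IsFractionRing.injective S L) g
  exact ⟨f.extendScalarsOfIsLocalization (nonZeroDivisors R) K, hf⟩

omit [IsDomain R] [IsDiscreteValuationRing R] in
theorem linearMap_ext_fractionRing (hp : p ≠ 0) (hpS : Irreducible (algebraMap R S p))
    {V : Type*} [AddCommGroup V] [Module K V]
    {f g : L →ₗ[K] V} (h : ∀ s, f (algebraMap S L s) = g (algebraMap S L s)) : f = g := by
  ext x
  obtain ⟨n, s, hs⟩ := exists_pow_mul_eq_algebraMap hpS x
  have hp' : algebraMap R K p ^ n ≠ 0 := pow_ne_zero n fun h ↦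
    hp (IsFractionRing.injective R K (h.trans (map_zero _).symm))
  have hs' : algebraMap R K p ^ n • x = algebraMap S L s := by
    rw [← hs, Algebra.smul_def, Algebra.smul_def]
    simp only [map_pow, ← IsScalarTower.algebraMap_apply]
  have h1 := h s
  rw [← hs', map_smul, map_smul] at h1
  exact smul_right_injective V hp' h1

variable (S L) in
/-- The projection from the fraction field of `R` to the quotient of the fraction field of `S`
by `S`. -/
def fractionQuotientMap : L →ₗ[R] FractionQuotient S L :=
  (Submodule.mkQ (LinearMap.range (Algebra.linearMap S L))).restrictScalars R

variable (R K L) in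
-- Surjectivity is L = K + S and exactness is K ∩ S = R.
theorem fractionRing_exact (hd : IsDenseModulo S p)
    (hp : Irreducible p) (hpS : Irreducible (algebraMap R S p)) :
    Function.Surjective
        (fractionQuotientMap S L ∘ₗ (IsScalarTower.toAlgHom R K L).toLinearMap) ∧
      Function.Exact (Algebra.linearMap R K)
        (fractionQuotientMap S L ∘ₗ (IsScalarTower.toAlgHom R K L).toLinearMap) := by
  constructor
  · intro x
    obtain ⟨x, rfl⟩ := Submodule.Quotient.mk_surjective _ x
    obtain ⟨k, s, rfl⟩ := hd.exists_add_eq (K := K) hp hpS x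
    exact ⟨k, mk_eq_mk_iff_exists_algebraMap.mpr ⟨-s, by rw [map_neg]; simp⟩⟩
  · intro k
    change (Submodule.Quotient.mk (algebraMap K L k) : FractionQuotient S L) = 0 ↔ _
    rw [Submodule.Quotient.mk_eq_zero]
    constructor
    · rintro ⟨s, hs⟩
      obtain ⟨r, rfl, -⟩ := exists_algebraMap_eq_of_eq hp hpS hs.symm
      exact ⟨r, rfl⟩
    · rintro ⟨r, rfl⟩
      refine ⟨algebraMap R S r, ?_⟩
      rw [Algebra.linearMap_apply, Algebra.linearMap_apply, ← IsScalarTower.algebraMap_apply,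
        ← IsScalarTower.algebraMap_apply]

theorem not_surjective_algebraMap_fractionRing (hp : Irreducible p)
    (hpS : Irreducible (algebraMap R S p)) (hsurj : ¬ Function.Surjective (algebraMap R S)) :
    ¬ Function.Surjective (algebraMap K L) := fun h ↦ hsurj fun s ↦ by
  obtain ⟨k, hk⟩ := h (algebraMap S L s)
  obtain ⟨r, -, rfl⟩ := exists_algebraMap_eq_of_eq hp hpS hk
  exact ⟨r, rfl⟩

theorem two_le_finrank_of_not_surjective {K L : Type*} [Field K] [Field L] [Algebra K L]
    [FiniteDimensional K L] (h : ¬ Function.Surjective (algebraMap K L)) :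
    2 ≤ Module.finrank K L := by
  have h0 : 0 < Module.finrank K L := Module.finrank_pos
  have h1 : Module.finrank K L ≠ 1 := fun h1 ↦ h fun x ↦ by
    obtain ⟨c, hc⟩ := (finrank_eq_one_iff_of_nonzero' (1 : L) one_ne_zero).mp h1 x
    exact ⟨c, by rw [← hc, Algebra.smul_def, mul_one]⟩
  lia

/-- The first extension module of the completion of a discrete valuation ring. -/
theorem ExtFromAlgebra.nonempty_linearEquiv_one [IsAdicComplete (maximalIdeal S) S]
    [FiniteDimensional K L] (hd : IsDenseModulo S p)
    (hp : Irreducible p) (hpS : Irreducible (algebraMap R S p))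
    (hsurj : ¬ Function.Surjective (algebraMap R S)) :
    Nonempty (ExtFromAlgebra R S R 1 ≃ₗ[S]
      FractionQuotient S L × (Fin (Module.finrank K L - 2) → L)) := by
  obtain ⟨hq, hiq⟩ := fractionRing_exact R K L hd hp hpS
  obtain ⟨δ, hδ, hδ0, hδs⟩ := ExtFromAlgebra.exists_connecting S
    (IsFractionRing.injective R K) hq hiq (injective_of_isFractionRing (R := R) (K := K) K)
  let : Module S (SourceHom K L L) := Module.compHom _ (algebraMap S L)
  have hsm (s : S) (f : SourceHom K L L) : s • f = algebraMap S L s • f := rfl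
  have : IsScalarTower S L (SourceHom K L L) := ⟨fun s a f ↦ by
    rw [hsm, Algebra.smul_def, mul_smul]⟩
  let ρ : SourceHom K L L → (S →ₗ[R] FractionQuotient S L) := fun f ↦
    fractionQuotientMap S L ∘ₗ (SourceHom.toHom f).restrictScalars R ∘ₗ
      (IsScalarTower.toAlgHom R S L).toLinearMap
  have hρ (f : SourceHom K L L) (s : S) :
    ρ f s = Submodule.Quotient.mk (SourceHom.toHom f (algebraMap S L s)) := rfl
  let Φ : SourceHom K L L →ₗ[S] ExtFromAlgebra R S R 1 :=
    { toFun f := δ (ρ f)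
      map_add' f g := by
        rw [← map_add]
        rfl
      map_smul' s f := by
        rw [RingHom.id_apply, ← hδs]
        congr 1
        ext t
        rw [hρ, hsm, SourceHom.toHom_smul_apply, LinearMap.comp_apply, LinearMap.mulLeft_apply, hρ,
          map_mul (algebraMap S L)] }
  have hΦ : Function.Surjective Φ := fun e ↦ by
    obtain ⟨f, rfl⟩ := hδ e
    obtain ⟨g, hg⟩ := hd.exists_lift hp hpS f
    obtain ⟨g', hg'⟩ := exists_extension_fractionRing (K := K) (L := L) L g
    refine ⟨g', congrArg δ (LinearMap.ext fun s ↦ ?_)⟩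
    rw [← hg, ← hg']
    rfl
  -- The dual Hom_K(L, K) is a line over L; τ spans it, so w spans the K-valued endomorphisms.
  obtain ⟨τ, hτ0, hτ⟩ := finrank_eq_one_iff'.mp
    ((SourceHom.finrank_eq K L K).trans (Module.finrank_self K))
  let v : SourceHom K L L := (LinearMap.id : L →ₗ[K] L)
  let w : SourceHom K L L := Algebra.linearMap K L ∘ₗ SourceHom.toHom τ
  have hv (x : L) : SourceHom.toHom v x = x := rfl
  have hw (x : L) : SourceHom.toHom w x = algebraMap K L (SourceHom.toHom τ x) := rfl
  have hvw : LinearIndependent L ![v, w] := by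
    refine LinearIndependent.pair_iff.mpr fun a b hab ↦ ?_
    have hab' (x : L) : a * x + algebraMap K L (SourceHom.toHom τ (b * x)) = 0 :=
      congrArg (fun f ↦ SourceHom.toHom f x) hab
    -- If a ≠ 0, the relation at x / a exhibits every x as an element of K.
    have ha : a = 0 := by
      by_contra ha
      refine not_surjective_algebraMap_fractionRing (K := K) (L := L) hp hpS hsurj fun x ↦
        ⟨-SourceHom.toHom τ (b * (a⁻¹ * x)), ?_⟩
      have := hab' (a⁻¹ * x)
      rw [mul_inv_cancel_left₀ ha] at this
      rw [map_neg]
      linear_combination -this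
    refine ⟨ha, ?_⟩
    by_contra hb
    refine hτ0 (SourceHom.ext fun x ↦ (algebraMap K L).injective ?_)
    have := hab' (b⁻¹ * x)
    rw [ha, zero_mul, zero_add, mul_inv_cancel_left₀ hb] at this
    rw [this, SourceHom.toHom_zero_apply, map_zero]
  have hker : ∀ f, Φ f = 0 ↔ ∃ (s : S) (b : L), f = s • v + b • w := by
    intro f
    refine (hδ0 (ρ f)).trans ⟨?_, ?_⟩
    · rintro ⟨h, hh⟩
      obtain ⟨h', hh'⟩ := exists_extension_fractionRing (K := K) (L := L) K h
      obtain ⟨b, hb⟩ := hτ h'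
      have hex : ∀ s : S, ∃ t : S, SourceHom.toHom f (algebraMap S L s) -
          algebraMap K L (h s) = algebraMap S L t := fun s ↦
        mk_eq_mk_iff_exists_algebraMap.mp (LinearMap.congr_fun hh s)
      choose g hg using hex
      -- The difference f - h takes S into S and is R-linear, so density makes it multiplication by
      -- g 1.
      let g' : S →ₗ[R] S :=
        { toFun := g
          map_add' := fun x y ↦ IsFractionRing.injective S L (by
            rw [← hg, map_add, map_add, map_add, map_add, map_add, ← hg, ← hg]; ring)
          map_smul' := fun r x ↦ IsFractionRing.injective S L (by
            have h1 : algebraMap S L (r • x) = algebraMap R K r • algebraMap S L x := by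
              rw [Algebra.smul_def, map_mul, Algebra.smul_def, ← IsScalarTower.algebraMap_apply,
                ← IsScalarTower.algebraMap_apply]
            rw [← hg, h1, map_smul, map_smul, RingHom.id_apply, Algebra.smul_def r (g x), map_mul,
              ← hg, Algebra.smul_def, Algebra.smul_def, map_mul,
              ← IsScalarTower.algebraMap_apply, ← IsScalarTower.algebraMap_apply]
            ring) }
      refine ⟨g 1, b, linearMap_ext_fractionRing hp.ne_zero hpS fun s ↦ ?_⟩
      change SourceHom.toHom f (algebraMap S L s) = algebraMap S L (g 1) * algebraMap S L s +
        algebraMap K L (SourceHom.toHom (b • τ) (algebraMap S L s))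
      rw [hb]
      have h2 : SourceHom.toHom h' (algebraMap S L s) = h s := hh' s
      have h3 : g s = s * g 1 := hd.map_eq_mul hpS g' s
      rw [h2, ← map_mul, mul_comm, ← h3, ← hg]
      ring
    · rintro ⟨s, b, rfl⟩
      refine ⟨(SourceHom.toHom (b • τ)).restrictScalars R ∘ₗ
        (IsScalarTower.toAlgHom R S L).toLinearMap, LinearMap.ext fun t ↦ ?_⟩
      refine mk_eq_mk_iff_exists_algebraMap.mpr ⟨s * t, ?_⟩
      change algebraMap S L s * algebraMap S L t + algebraMap K L _ - algebraMap K L _ = _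
      rw [map_mul]
      exact add_sub_cancel_right _ _
  have := nonempty_linearEquiv_of_ker_eq Φ hΦ hvw hker
  rwa [SourceHom.finrank_eq] at this

end DenseExtension

/-! ### Independence of the fraction fields and conclusion -/

/-- The degree of an extension of fraction fields does not depend on the choice of the fraction
fields. -/
theorem finrank_fractionRing_eq {R S K L K' L' : Type*} [CommRing R] [IsDomain R] [CommRing S]
    [IsDomain S] [Algebra R S]
    [Field K] [Algebra R K] [IsFractionRing R K] [CommRing L] [Algebra S L] [IsFractionRing S L]
    [Algebra R L] [IsScalarTower R S L] [Algebra K L] [IsScalarTower R K L]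
    [Field K'] [Algebra R K'] [IsFractionRing R K'] [CommRing L'] [Algebra S L']
    [IsFractionRing S L'] [Algebra R L'] [IsScalarTower R S L'] [Algebra K' L']
    [IsScalarTower R K' L'] : Module.finrank K L = Module.finrank K' L' := by
  let i : K ≃ₐ[R] K' := IsLocalization.algEquiv (nonZeroDivisors R) K K'
  let j : L ≃ₐ[S] L' := IsLocalization.algEquiv (nonZeroDivisors S) L L'
  refine Algebra.finrank_eq_of_equiv_equiv i.toRingEquiv j.toRingEquiv ?_
  refine IsLocalization.ringHom_ext (nonZeroDivisors R) (RingHom.ext fun r ↦ ?_)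
  change algebraMap K' L' (i (algebraMap R K r)) = j (algebraMap K L (algebraMap R K r))
  rw [AlgEquiv.commutes, ← IsScalarTower.algebraMap_apply, ← IsScalarTower.algebraMap_apply,
    IsScalarTower.algebraMap_apply R S L, AlgEquiv.commutes, ← IsScalarTower.algebraMap_apply]

theorem proposition4p5
    (R : Type u) [CommRing R] [IsDomain R] [IsDiscreteValuationRing R]
    (hR : ¬ IsAdicComplete (IsLocalRing.maximalIdeal R) R)
    -- `K` is the fraction field of `R`, `Kt` is that of the completion of `R`
    (K : Type*) [Field K] [Algebra R K] [IsFractionRing R K]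
    (Kt : Type*) [CommRing Kt] [Algebra (LocalCompletion R) Kt]
    [IsFractionRing (LocalCompletion R) Kt]
    -- `Kt` is an extension of `K` through the natural map from `R` to its completion
    [Algebra R Kt] [IsScalarTower R (LocalCompletion R) Kt]
    [Algebra K Kt] [IsScalarTower R K Kt]
    [FiniteDimensional K Kt] :
    (∀ i : ℕ, i ≠ 1 → Subsingleton (ExtFromAlgebra R (LocalCompletion R) R i)) ∧
    -- the exponent `[Kt : K] - 2` below is not truncated
    2 ≤ Module.finrank K Kt ∧
    -- there is a module `E` that is an injective hull of the residue field over both rings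
    (∃ (E : Type u) (_ : AddCommGroup E) (_ : Module R E) (_ : Module (LocalCompletion R) E),
      IsScalarTower R (LocalCompletion R) E ∧
      IsInjectiveHull R (IsLocalRing.ResidueField R) E ∧
      IsInjectiveHull (LocalCompletion R)
        (IsLocalRing.ResidueField (LocalCompletion R)) E) ∧
    ∀ (E : Type u) [AddCommGroup E] [Module (LocalCompletion R) E],
      IsInjectiveHull (LocalCompletion R)
        (IsLocalRing.ResidueField (LocalCompletion R)) E →
      Nonempty (ExtFromAlgebra R (LocalCompletion R) R 1 ≃ₗ[LocalCompletion R]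
        E × (Fin (Module.finrank K Kt - 2) → Kt)) := by
  obtain ⟨p, hp⟩ := IsDiscreteValuationRing.exists_irreducible R
  have hpS := LocalCompletion.irreducible_algebraMap R hp
  have hd : IsDenseModulo (LocalCompletion R) p := fun s ↦ by
    obtain ⟨r, t, h⟩ := LocalCompletion.exists_eq_add_mul R hp s
    exact ⟨r, t, by rw [h, Algebra.smul_def]⟩
  have hsurj := LocalCompletion.not_surjective_algebraMap R hR
  -- The given K and Kt may live in other universes, so the computation runs in the canonical
  -- fraction fields and is transported at the end.
  let K₀ := FractionRing R
  let L₀ := FractionRing (LocalCompletion R)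
  have : FaithfulSMul R L₀ := by
    rw [faithfulSMul_iff_algebraMap_injective, IsScalarTower.algebraMap_eq R (LocalCompletion R) L₀]
    exact (IsFractionRing.injective (LocalCompletion R) L₀).comp
      (LocalCompletion.algebraMap_injective R)
  let : Algebra K₀ L₀ := FractionRing.liftAlgebra R L₀
  have : IsScalarTower R K₀ L₀ := FractionRing.isScalarTower_liftAlgebra R L₀
  have hrank : Module.finrank K Kt = Module.finrank K₀ L₀ :=
    finrank_fractionRing_eq (R := R) (S := LocalCompletion R)
  have : Nontrivial Kt := (IsFractionRing.injective (LocalCompletion R) Kt).nontrivial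
  have hfin : FiniteDimensional K₀ L₀ :=
    Module.finite_of_finrank_pos (hrank ▸ Module.finrank_pos)
  obtain ⟨hq, hiq⟩ := fractionRing_exact R K₀ L₀ hd hp hpS
  have hhull := FractionQuotient.isInjectiveHull_of_isDenseModulo (L := L₀) hd hp hpS
  refine ⟨fun i hi ↦ ?_, ?_, ?_, fun E _ _ hE ↦ ?_⟩
  · obtain _ | _ | i := i
    · exact ExtFromAlgebra.subsingleton_zero _ fun f ↦ hd.eq_zero_of_not_surjective hp hpS hsurj f
    · exact (hi rfl).elim
    · exact ExtFromAlgebra.subsingleton_add_two _ (IsFractionRing.injective R K₀) hq hiq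
        (injective_of_isFractionRing (R := R) (K := K₀) K₀) hhull.1 i
  · rw [hrank]
    exact two_le_finrank_of_not_surjective (not_surjective_algebraMap_fractionRing hp hpS hsurj)
  · exact ⟨FractionQuotient (LocalCompletion R) L₀, inferInstance, inferInstance, inferInstance,
      inferInstance, hhull, FractionQuotient.isInjectiveHull⟩
  · obtain ⟨e⟩ := ExtFromAlgebra.nonempty_linearEquiv_one (K := K₀) (L := L₀) hd hp hpS hsurj
    obtain ⟨e'⟩ := (FractionQuotient.isInjectiveHull (L := L₀)).nonempty_linearEquiv hE
    have j : L₀ ≃ₗ[LocalCompletion R] Kt :=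
      (IsLocalization.algEquiv (nonZeroDivisors (LocalCompletion R)) L₀ Kt).toLinearEquiv
    rw [hrank]
    exact ⟨e ≪≫ₗ e'.prodCongr (LinearEquiv.piCongrRight fun _ ↦ j)⟩
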